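/- **Proposition 3.2.** Fix an algebraic closure $\overline{\mathbb Q}$ of $\mathbb Q$, an integer $d>1$ and an integer $\ell\ge 1$. For a number field $K$ let $D_K$ be the absolute value of its discriminant, let $\mathrm{Cl}_K[\ell]$ be the group of ideal classes of $K$ whose $\ell$-th power is trivial, let $H_K(\alpha)=\prod_{v}\max\{1,|\alpha|_v\}^{d_v}$ ($v$ over all places of $K$, $|\cdot|_v$ extending a usual absolute value of $\mathbb Q$, $d_v$ the local degree) be the multiplicative Weil height relative to $K$, and let $\eta_\ell(K)$ be the infimum of $H_K(\alpha)$ over all $\alpha\in K$ with $\alpha\mathcal O_K=(\mathfrak p_1\mathfrak p_2^{-1})^\ell$ for some nonzero prime ideals $\mathfrak p_1\ne\mathfrak p_2$ of $\mathcal O_K$, both of ramification index $1$ and inertia degree $1$ over $\mathbb Q$. For a set $S$ of number fields $K\subset\overline{\mathbb Q}$ with $[K:\mathbb Q]=d$ put $S_X=\{K\in S: X\le D_K<2X\}$, and let $\mathscr B_S(X;Y,M)$ be the set of $K\in S_X$ such that at most $M$ rational primes $p\le Y$ split completely in $K$. Let $\theta,\rho,c_1,c_3>0$ and $\tau\ge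 0$ be real numbers, and for all $\delta>0$ and $\varepsilon\in(0,1/\ell)$ let $c_4(\delta,\varepsilon)$ and $c_5(\delta,\varepsilon)$ be positive real numbers. Suppose that $S$ is a set of number fields $K\subset\overline{\mathbb Q}$ of degree $d$ such that, for all real $X\ge 2$, $$\#S_X\le c_1X^{\rho},\qquad \#\{K\in S:\eta_\ell(K)<X\}\le c_3X^{\theta},$$ and such that, for all $\delta>0$, all $\varepsilon\in(0,1/\ell)$ and all real $X\ge 2$, $$\#\mathscr B_S\bigl(X;X^{\delta},c_4(\delta,\varepsilon)X^{\delta}/\log X\bigr)\le c_5(\delta,\varepsilon)X^{\tau+\varepsilon}.$$ Then for all real $k\ge 0$, all $\varepsilon\in(0,1/\ell)$ and all real $X\ge 2$, $$\sum_{K\in S_X}\bigl(\#\mathrm{Cl}_K[\ell]\bigr)^k\ \le\ C\Bigl(X^{\frac k2+\rho-\frac{\rho k}{\ell\theta}+\varepsilon}+X^{\frac k2+\tau+\varepsilon}\Bigr),$$ where $C>0$ depends only on $d,\theta,\rho,c_1,c_3,\ell,k,\tau,\varepsilon$ and the functions $c_4(\cdot,\cdot)$, $c_5(\cdot,\cdot)$;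 in particular, not on $S$ or $X$. -/

import Mathlib

open NumberField
open scoped nonZeroDivisors

noncomputable section

/-- The number fields contained in the fixed algebraic closure of `ℚ`. -/
abbrev NumFieldQbar : Type :=
  {K : IntermediateField ℚ (AlgebraicClosure ℚ) // FiniteDimensional ℚ K}

instance instNumberFieldNumFieldQbar (K : NumFieldQbar) : NumberField K.1 :=
  @NumberField.mk _ _ inferInstance K.2

/-- `S_{ℚ,d}`: the number fields `K ⊂ ℚ̄` with `[K : ℚ] = d`. -/
def fieldsOfDegree (d : ℕ) : Set NumFieldQbar := {K | Module.finrank ℚ K.1 = d}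

/-- `D_K`, the absolute value of the discriminant of `K`. -/
def absDiscr (K : Type*) [Field K] [NumberField K] : ℝ := ((|discr K| : ℤ) : ℝ)

/-- A nonzero prime ideal `𝔭` of `𝓞 K` with ramification index `e(𝔭) = 1` and inertia degree
`f(𝔭) = 1` over the rational prime below it. -/
def IsDegreeOneUnramified {K : Type*} [Field K] [NumberField K] (P : Ideal (𝓞 K)) : Prop :=
  P.IsPrime ∧ P ≠ ⊥ ∧ P.ramificationIdx ℤ = 1 ∧ P.inertiaDeg ℤ = 1

/-- The invariant `η_ℓ(K)`: the infimum of the multiplicative Weil heights, relative to `K`, of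
the elements `α ∈ K` with `α 𝓞_K = (𝔭₁ 𝔭₂⁻¹)^ℓ` as fractional ideals, where `𝔭₁ ≠ 𝔭₂` are prime
ideals of `𝓞_K` with `e(𝔭ᵢ) = f(𝔭ᵢ) = 1`. Here `Height.mulHeight₁` on a number field is the
relative height `∏_v max(1, |α|_v)^{d_v}`. -/
def etaInvariant (ℓ : ℕ) (K : Type*) [Field K] [NumberField K] : ℝ :=
  sInf {h : ℝ | ∃ (α : K) (P₁ P₂ : Ideal (𝓞 K)), P₁ ≠ P₂ ∧
    IsDegreeOneUnramified P₁ ∧ IsDegreeOneUnramified P₂ ∧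
    FractionalIdeal.spanSingleton (𝓞 K)⁰ α =
      ((P₁ : FractionalIdeal (𝓞 K)⁰ K) * (P₂ : FractionalIdeal (𝓞 K)⁰ K)⁻¹) ^ ℓ ∧
    h = Height.mulHeight₁ α}

/-- The rational prime `p` splits completely in `K`: all primes of `𝓞 K` above `p` have
ramification index and inertia degree `1`. -/
def SplitsCompletelyIn (p : ℕ) (K : Type*) [Field K] [NumberField K] : Prop :=
  ∀ P : Ideal (𝓞 K), P.IsPrime → P.LiesOver (Ideal.span {(p : ℤ)}) →
    P.ramificationIdx ℤ = 1 ∧ P.inertiaDeg ℤ = 1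

/-- The number of primes `p ≤ Y` that split completely in `K`. -/
def numSplitPrimes (K : Type*) [Field K] [NumberField K] (Y : ℝ) : ℕ :=
  {p : ℕ | p.Prime ∧ (p : ℝ) ≤ Y ∧ SplitsCompletelyIn p K}.ncard

/-- `#Cl_K[ℓ]`, the number of ideal classes whose `ℓ`-th power is trivial. -/
def classTorsionCard (ℓ : ℕ) (K : Type*) [Field K] [NumberField K] : ℕ :=
  Nat.card {c : ClassGroup (𝓞 K) // c ^ ℓ = 1}

/-- `S_X = {K ∈ S ; X ≤ D_K < 2X}`. -/
def dyadicPart (S : Set NumFieldQbar) (X : ℝ) : Set NumFieldQbar :=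
  {K | K ∈ S ∧ X ≤ absDiscr K.1 ∧ absDiscr K.1 < 2 * X}

/-- `𝓑_S(X; Y, M)`: the fields in `S_X` in which at most `M` primes `p ≤ Y` split completely. -/
def badFields (S : Set NumFieldQbar) (X Y M : ℝ) : Set NumFieldQbar :=
  {K | K ∈ dyadicPart S X ∧ (numSplitPrimes K.1 Y : ℝ) ≤ M}

/-- `{K ∈ S ; η_ℓ(K) < X}`, whose cardinality is `N_{η_ℓ}(S, X)`. -/
def etaBounded (ℓ : ℕ) (S : Set NumFieldQbar) (X : ℝ) : Set NumFieldQbar :=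
  {K | K ∈ S ∧ etaInvariant ℓ K.1 < X}

/-- By Hermite's theorem, `S_X` is finite. -/
theorem dyadicPart_finite (S : Set NumFieldQbar) (X : ℝ) : (dyadicPart S X).Finite := by
  refine (NumberField.finite_of_discr_bdd (AlgebraicClosure ℚ) ⌊2 * X⌋₊).subset ?_
  rintro K ⟨-, -, h⟩
  have h0 : ((|discr K.1| : ℤ) : ℝ) < 2 * X := h
  have h2 : (discr K.1).natAbs ≤ ⌊2 * X⌋₊ :=
    Nat.le_floor (by rw [Nat.cast_natAbs]; exact h0.le)
  change |discr K.1| ≤ _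
  rw [Int.abs_eq_natAbs]
  exact_mod_cast h2

/-- The family `S_X` as a finite set. -/
def dyadicFinset (S : Set NumFieldQbar) (X : ℝ) : Finset NumFieldQbar :=
  (dyadicPart_finite S X).toFinset

end

/-!
The proof bounds `#Cl_K[ℓ]` in terms of the number of small degree one primes whenever `η_ℓ(K)` is
large, and then averages over the family.

*The pointwise bound.* It is proved without class number formula or regulators, by an injection. Let
`c` be an `ℓ`-torsion class, represented by an ideal `I` with `I ^ ℓ = (γ)`, and let `P` be a prime of
degree one and norm at most `Y`. The numbers `|γ|_w ^ (-1 / ℓ)` at the infinite places lift `c` to an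
`ℓ`-torsion Arakelov class; the norm of `P` is spread evenly over the infinite places. Minkowski's
theorem for these weights gives `β` such that `J = β I P` is an integral ideal of norm at most
`2 √D_K` and the weighted absolute values of `β` have logarithms in an interval of length
`O(log D_K)`; these are rounded to integers. If `(c, P)` and `(c', P')` yield the same `J` and the
same integers, then `(β' / β) ^ ℓ γ' / γ` generates `(P P'⁻¹) ^ ℓ` and has height at most
`exp (ℓ d) Y ^ ℓ`, so that `P = P'` if `η_ℓ(K)` exceeds this bound, and then `c = c'`. Hence
`#Cl_K[ℓ]` times the number of primes is at most the number of pairs of a `J` and a tuple of integers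
(`classTorsionCard_mul_card_le`). With `P = (1)` alone, the argument gives the trivial bound
`#Cl_K[ℓ] ≪ D_K ^ (1 / 2 + ε)`. The ideals `J` are counted uniformly in `K` by
comparison with `ζ(s) ^ d` (`ncard_absNorm_le`).

*The average.* With `δ_j = (j / N) ρ / (ℓ θ)` for `0 ≤ j ≤ N`, the fields which have few split primes
up to `X ^ δ_j` for some `j ≥ 1` are few by hypothesis, and the trivial bound accounts for the term
`X ^ (k / 2 + τ + ε)`. The others are sorted by the largest `j` with `j = 0` or
`exp (ℓ d) X ^ (ℓ δ_j) < η_ℓ(K)`.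
There are `≪ X ^ (ℓ θ δ_j + ρ / N)` of them for each `j`, by the hypothesis on `η_ℓ` for `j < N` and
by the bound for `#S_X` for `j = N`, and each contributes `≪ X ^ (k (1 / 2 - δ_j) + ε / 4)`. The
resulting exponent is linear in `δ_j`, so the end points `j = 0` and `j = N` dominate.
-/

/-! ### Counting integral ideals of bounded norm -/

section IdealCount

open UniqueFactorizationMonoid

theorem exists_prime_liesOver {K : Type*} [Field K] (P : Ideal (𝓞 K)) [P.IsPrime] (hP : P ≠ ⊥) :
    ∃ p : ℕ, p.Prime ∧ P.LiesOver (Ideal.span {(p : ℤ)}) := by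
  have h0 : P.under ℤ ≠ ⊥ := Ideal.IsIntegral.comap_ne_bot ℤ hP
  have hspan := Int.ideal_span_absNorm_eq_self (P.under ℤ)
  refine ⟨Ideal.absNorm (P.under ℤ), ?_, ?_⟩
  · have hpr : (P.under ℤ).IsPrime := inferInstance
    rw [← hspan, Ideal.span_singleton_prime] at hpr
    · exact Nat.prime_iff_prime_int.mpr hpr
    · intro h
      apply h0
      rw [← hspan, h]
      simp
  · rw [hspan]
    exact ⟨rfl⟩

variable {K : Type*} [Field K] [NumberField K]

theorem ncard_primesOver_le_finrank (p : Ideal ℤ) [p.IsPrime] :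
    (p.primesOver (𝓞 K)).ncard ≤ Module.finrank ℚ K := by
  have hfin : (p.primesOver (𝓞 K)).Finite := Algebra.QuasiFinite.finite_primesOver p
  let := hfin.fintype
  rw [← RingOfIntegers.rank K, ← Ideal.sum_ramification_inertia_eq_finrank p (𝓞 K),
    ← Nat.card_coe_set_eq, Nat.card_eq_fintype_card, Fintype.card_eq_sum_ones]
  refine Finset.sum_le_sum fun q _ ↦ ?_
  have : q.1.IsPrime := q.2.1
  exact Right.one_le_mul (Ideal.ramificationIdx_pos q.1 ℤ) (Ideal.inertiaDeg_pos q.1 ℤ)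

variable (K) in
/-- The primes of `𝓞 K` can be coloured with `[K : ℚ]` colours in such a way that primes above the
same rational prime receive different colours. -/
theorem exists_primes_colouring :
    ∃ f : Ideal (𝓞 K) → Fin (Module.finrank ℚ K), ∀ p : Ideal ℤ, p.IsPrime →
      Set.InjOn f (p.primesOver (𝓞 K)) := by
  classical
  have hn : 0 < Module.finrank ℚ K := Module.finrank_pos
  have key (p : Ideal ℤ) : ∃ g : Ideal (𝓞 K) → Fin (Module.finrank ℚ K), p.IsPrime →
      Set.InjOn g (p.primesOver (𝓞 K)) := by
    by_cases hp : p.IsPrime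
    · have hfin : (p.primesOver (𝓞 K)).Finite := Algebra.QuasiFinite.finite_primesOver p
      have : Nonempty (Fin (Module.finrank ℚ K)) := ⟨⟨0, hn⟩⟩
      obtain ⟨g, -, hg⟩ := hfin.exists_injOn_of_encard_le
        (t := (Set.univ : Set (Fin (Module.finrank ℚ K)))) (by
          rw [← hfin.cast_ncard_eq, Set.encard_univ, ENat.card_eq_coe_fintype_card,
            Fintype.card_fin]
          exact_mod_cast ncard_primesOver_le_finrank p)
      exact ⟨g, fun _ ↦ hg⟩
    · exact ⟨fun _ ↦ ⟨0, hn⟩, fun h ↦ (hp h).elim⟩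
  choose g hg using key
  refine ⟨fun P ↦ g (P.under ℤ) P, fun p hp P hP Q hQ h ↦ ?_⟩
  have hP' : P.under ℤ = p := hP.2.over.symm
  have hQ' : Q.under ℤ = p := hQ.2.over.symm
  simp only [hP', hQ'] at h
  exact hg p hp hP hQ h

/-- If no prime in `s` other than `P` lies above the rational prime `p` below `P`, then the
exponent of `p` in the norm of `∏ s` determines the multiplicity of `P` in `s`. -/
theorem factorization_absNorm_prod (s : Multiset (Ideal (𝓞 K)))
    (hs : ∀ Q ∈ s, Q.IsPrime ∧ Q ≠ ⊥) (P : Ideal (𝓞 K)) (p : ℕ) (hp : p.Prime)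
    (hPs : ∀ Q ∈ s, Q.LiesOver (Ideal.span {(p : ℤ)}) → Q = P) :
    (Ideal.absNorm s.prod).factorization p =
      s.count P * (Ideal.absNorm P).factorization p := by
  classical
  induction s using Multiset.induction_on with
  | empty => simp
  | cons Q s ih =>
    have hQ := hs Q (by simp)
    have hs' : ∀ R ∈ s, R.IsPrime ∧ R ≠ ⊥ := fun R hR ↦ hs R (by simp [hR])
    have h1 : Ideal.absNorm Q ≠ 0 := by simpa [Ideal.absNorm_eq_zero_iff] using hQ.2
    have h2 : Ideal.absNorm s.prod ≠ 0 := by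
      rw [Ne, Ideal.absNorm_eq_zero_iff]
      exact Multiset.prod_ne_zero fun h ↦ (hs' _ h).2 rfl
    rw [Multiset.prod_cons, map_mul, Nat.factorization_mul h1 h2, Finsupp.add_apply,
      ih hs' fun R hR ↦ hPs R (by simp [hR]), Multiset.count_cons]
    by_cases hPQ : P = Q
    · simp [hPQ]
      ring
    · have : Q.IsPrime := hQ.1
      obtain ⟨q, hq, hQq⟩ := exists_prime_liesOver Q hQ.2
      have hqp : q ≠ p := by
        rintro rfl
        exact hPQ (hPs Q (by simp) hQq).symm
      rw [← Ideal.pow_inertiaDeg q Q, Nat.Prime.factorization_pow hq]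
      simp [hPQ, hqp]

/-- Rankin's trick for a set of tuples of positive integers with bounded product. -/
theorem card_le_of_injOn_prod_le {ι : Type*} (T : Finset ι) (n : ℕ) (f : ι → Fin n → ℕ)
    (hf : Set.InjOn f T) (x : ℝ) (hx0 : 0 ≤ x) (h1 : ∀ t ∈ T, ∀ i, 1 ≤ f t i)
    (hx : ∀ t ∈ T, ((∏ i, f t i : ℕ) : ℝ) ≤ x) (s : ℝ) (hs : 1 < s) :
    (T.card : ℝ) ≤ x ^ s * (∑' m : ℕ, ((m : ℝ) ^ s)⁻¹) ^ n := by
  classical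
  have hle : ∀ t ∈ T, ∀ i, f t i ≤ ⌊x⌋₊ := fun t ht i ↦ by
    refine le_trans ?_ (Nat.le_floor (hx t ht))
    exact Nat.le_of_dvd (Finset.prod_pos fun j _ ↦ h1 t ht j)
      (Finset.dvd_prod_of_mem _ (Finset.mem_univ i))
  have hsum : Summable fun m : ℕ ↦ ((m : ℝ) ^ s)⁻¹ := Real.summable_nat_rpow_inv.mpr hs
  calc (T.card : ℝ) = ∑ t ∈ T, (1 : ℝ) := by simp
    _ ≤ ∑ t ∈ T, x ^ s * ∏ i, ((f t i : ℝ) ^ s)⁻¹ := by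
      refine Finset.sum_le_sum fun t ht ↦ ?_
      have hpos : (0 : ℝ) < ((∏ i, f t i : ℕ) : ℝ) := by
        exact_mod_cast Finset.prod_pos fun j _ ↦ h1 t ht j
      rw [Finset.prod_inv_distrib, Real.finsetProd_rpow _ _ (fun i _ ↦ Nat.cast_nonneg _),
        ← Nat.cast_prod, ← div_eq_mul_inv, one_le_div (Real.rpow_pos_of_pos hpos _)]
      exact Real.rpow_le_rpow hpos.le (hx t ht) (by linarith)
    _ = x ^ s * ∑ u ∈ T.image f, ∏ i, ((u i : ℝ) ^ s)⁻¹ := by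
      rw [← Finset.mul_sum, Finset.sum_image hf]
    _ ≤ x ^ s * ∑ u ∈ Fintype.piFinset fun _ : Fin n ↦ Finset.range (⌊x⌋₊ + 1),
          ∏ i, ((u i : ℝ) ^ s)⁻¹ := by
      refine mul_le_mul_of_nonneg_left (Finset.sum_le_sum_of_subset_of_nonneg ?_
        fun u _ _ ↦ Finset.prod_nonneg fun i _ ↦ by positivity) (by positivity)
      intro u hu
      obtain ⟨t, ht, rfl⟩ := Finset.mem_image.mp hu
      simp only [Fintype.mem_piFinset, Finset.mem_range]
      exact fun i ↦ Nat.lt_succ_of_le (hle t ht i)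
    _ = x ^ s * (∑ m ∈ Finset.range (⌊x⌋₊ + 1), ((m : ℝ) ^ s)⁻¹) ^ n := by
      rw [← Finset.prod_univ_sum (fun _ : Fin n ↦ Finset.range (⌊x⌋₊ + 1))
        fun _ m ↦ ((m : ℝ) ^ s)⁻¹]
      simp
    _ ≤ x ^ s * (∑' m : ℕ, ((m : ℝ) ^ s)⁻¹) ^ n := by
      gcongr
      exact hsum.sum_le_tsum _ fun m _ ↦ by positivity

variable (K) in
theorem finite_absNorm_le (x : ℝ) :
    {J : Ideal (𝓞 K) | J ≠ ⊥ ∧ (Ideal.absNorm J : ℝ) ≤ x}.Finite :=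
  (Ideal.finite_setOfPred_absNorm_le ⌊x⌋₊).subset fun _ hJ ↦ Nat.le_floor hJ.2

variable (K) in
/-- The number of ideals of norm at most `x` is bounded uniformly in all number fields of a given
degree. Grouping the prime factors of an ideal by colour gives `[K : ℚ]` norms, which determine the
ideal, so that the Dirichlet series of the counting function is at most `ζ(s) ^ [K : ℚ]`. -/
theorem ncard_absNorm_le (x : ℝ) (hx : 0 ≤ x) (s : ℝ) (hs : 1 < s) :
    ({J : Ideal (𝓞 K) | J ≠ ⊥ ∧ (Ideal.absNorm J : ℝ) ≤ x}.ncard : ℝ) ≤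
      x ^ s * (∑' m : ℕ, ((m : ℝ) ^ s)⁻¹) ^ Module.finrank ℚ K := by
  classical
  obtain ⟨c, hc⟩ := exists_primes_colouring K
  have hfin := finite_absNorm_le K x
  rw [Set.ncard_eq_toFinset_card _ hfin]
  let part (J : Ideal (𝓞 K)) (i : Fin (Module.finrank ℚ K)) : Multiset (Ideal (𝓞 K)) :=
    (normalizedFactors J).filter fun P ↦ c P = i
  have hpart (J : Ideal (𝓞 K)) (i) : ∀ Q ∈ part J i, Q.IsPrime ∧ Q ≠ ⊥ := fun Q hQ ↦ by
    have := prime_of_normalized_factor Q (Multiset.mem_of_mem_filter hQ)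
    exact ⟨Ideal.isPrime_of_prime this, this.ne_zero⟩
  have hprod (J : Ideal (𝓞 K)) (hJ : J ≠ ⊥) : ∏ i, (part J i).prod = J := by
    conv_rhs => rw [← Ideal.prod_normalizedFactors_eq_self hJ]
    rw [← Multiset.prod_sum]
    congr 1
    ext P
    simp [part, Multiset.count_sum', Multiset.count_filter]
  refine card_le_of_injOn_prod_le hfin.toFinset _
    (fun J i ↦ Ideal.absNorm (part J i).prod) ?_ x hx ?_ ?_ s hs
  · intro J hJ J' hJ' h
    simp only [Set.Finite.coe_toFinset, Set.mem_ofPred_eq] at hJ hJ'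
    rw [← Ideal.prod_normalizedFactors_eq_self hJ.1, ← Ideal.prod_normalizedFactors_eq_self hJ'.1]
    congr 1
    ext P
    by_cases hP : P.IsPrime ∧ P ≠ ⊥
    · have := hP.1
      obtain ⟨p, hp, hPp⟩ := exists_prime_liesOver P hP.2
      have hpp : (Ideal.span {(p : ℤ)}).IsPrime := by
        rw [Ideal.span_singleton_prime (by exact_mod_cast hp.ne_zero)]
        exact Nat.prime_iff_prime_int.mp hp
      have key (I : Ideal (𝓞 K)) := factorization_absNorm_prod (part I (c P)) (hpart I _) P p hp
        fun Q hQ hQp ↦ hc _ hpp ⟨(hpart I _ Q hQ).1, hQp⟩ ⟨this, hPp⟩ (Multiset.mem_filter.mp hQ).2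
      have hpos : (Ideal.absNorm P).factorization p ≠ 0 := by
        rw [← Ideal.pow_inertiaDeg p P, Nat.Prime.factorization_pow hp]
        simpa using (Ideal.inertiaDeg_pos P ℤ).ne'
      have h1 := key J
      have h2 := key J'
      have h3 := congrFun h (c P)
      simp only at h3
      rw [h3, h2] at h1
      have h4 := Nat.eq_of_mul_eq_mul_right (Nat.pos_of_ne_zero hpos) h1
      simp only [part] at h4
      simpa [Multiset.count_filter] using h4.symm
    · have h0 (I : Ideal (𝓞 K)) : (normalizedFactors I).count P = 0 := by
        rw [Multiset.count_eq_zero]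
        intro hmem
        have := prime_of_normalized_factor P hmem
        exact hP ⟨Ideal.isPrime_of_prime this, this.ne_zero⟩
      rw [h0, h0]
  · intro J _ i
    rw [Nat.one_le_iff_ne_zero, Ne, Ideal.absNorm_eq_zero_iff]
    exact Multiset.prod_ne_zero fun h ↦ (hpart J i _ h).2 rfl
  · intro J hJ
    simp only [Set.Finite.mem_toFinset, Set.mem_ofPred_eq] at hJ
    rw [← map_prod, hprod J hJ.1]
    exact hJ.2

end IdealCount

/-! ### Minkowski's theorem with prescribed archimedean weights -/

section Minkowski

open MeasureTheory NumberField.InfinitePlace NumberField.mixedEmbedding ENNReal NNReal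

variable {K : Type*} [Field K] [NumberField K]

theorem exists_ne_zero_mem_fractionalIdeal_lt (I : (FractionalIdeal (𝓞 K)⁰ K)ˣ)
    (g : InfinitePlace K → ℝ) (hg : ∀ w, 0 < g w)
    (h : 2 * √(absDiscr K) * (FractionalIdeal.absNorm I.1 : ℝ) ≤ ∏ w, g w ^ mult w) :
    ∃ a ∈ (I : FractionalIdeal (𝓞 K)⁰ K), a ≠ 0 ∧ ∀ w : InfinitePlace K, w a < g w := by
  classical
  lift g to InfinitePlace K → ℝ≥0 using fun w ↦ (hg w).le
  have hN : 0 < (FractionalIdeal.absNorm I.1 : ℝ) := by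
    have h1 : FractionalIdeal.absNorm I.1 ≠ 0 := by
      rw [Ne, FractionalIdeal.absNorm_eq_zero_iff]
      exact I.ne_zero
    exact_mod_cast lt_of_le_of_ne (FractionalIdeal.absNorm_nonneg I.1) h1.symm
  have hD : 0 < √(absDiscr K) := by
    rw [Real.sqrt_pos, absDiscr]
    exact_mod_cast abs_pos.mpr (discr_ne_zero K)
  have hlt : minkowskiBound K I < volume (convexBodyLT K g) := by
    have hvol : volume (convexBodyLT K g) ≠ ⊤ := by
      rw [convexBodyLT_volume]
      exact ENNReal.coe_ne_top
    rw [← ENNReal.toReal_lt_toReal (minkowskiBound_lt_top K I).ne hvol, minkowskiBound,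
      convexBodyLT_volume, volume_fundamentalDomain_fractionalIdealLatticeBasis,
      volume_fundamentalDomain_latticeBasis]
    simp only [toReal_mul, toReal_pow, toReal_inv, coe_toReal, toReal_ofNat,
      ENNReal.toReal_ofReal hN.le, NNReal.coe_mul, NNReal.coe_pow, NNReal.coe_prod,
      NNReal.coe_ofNat, NNReal.coe_real_pi, Real.coe_sqrt, coe_nnnorm,
      mixedEmbedding.finrank, Int.norm_eq_abs]
    rw [← card_add_two_mul_card_eq_rank, pow_add, pow_mul]
    have hd : absDiscr K = |(discr K : ℝ)| := by simp [absDiscr]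
    rw [hd] at h hD
    have hpi : (2 : ℝ) ^ nrComplexPlaces K ≤ Real.pi ^ nrComplexPlaces K :=
      pow_le_pow_left₀ (by norm_num) Real.two_le_pi _
    have h4 : ((2 : ℝ) ^ 2) ^ nrComplexPlaces K =
        2 ^ nrComplexPlaces K * 2 ^ nrComplexPlaces K := by
      rw [← mul_pow]; norm_num
    rw [h4]
    calc _ = 2 ^ nrRealPlaces K * 2 ^ nrComplexPlaces K *
          (√|(discr K : ℝ)| * (FractionalIdeal.absNorm I.1 : ℝ)) := by
            rw [inv_pow]; field_simp
      _ < 2 ^ nrRealPlaces K * 2 ^ nrComplexPlaces K *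
          (2 * √|(discr K : ℝ)| * (FractionalIdeal.absNorm I.1 : ℝ)) := by
            gcongr; linarith
      _ ≤ _ := by gcongr
  exact exists_ne_zero_mem_ideal_lt K I hlt

end Minkowski

/-! ### Bounding torsion classes by counting reduced divisors -/

section Reduction

open NumberField.InfinitePlace

variable {K : Type*} [Field K] [NumberField K]

theorem one_le_absDiscr : 1 ≤ absDiscr K := by
  rw [absDiscr]
  exact_mod_cast Int.one_le_abs (discr_ne_zero K)

theorem exists_ideal_pow_eq_span {ℓ : ℕ} (c : ClassGroup (𝓞 K)) (hc : c ^ ℓ = 1) :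
    ∃ (I : (Ideal (𝓞 K))⁰) (γ : 𝓞 K), γ ≠ 0 ∧ ClassGroup.mk0 I = c ∧
      (I : Ideal (𝓞 K)) ^ ℓ = Ideal.span {γ} := by
  obtain ⟨I, rfl⟩ := ClassGroup.mk0_surjective c
  rw [← map_pow] at hc
  have h1 := (ClassGroup.mk0_eq_one_iff (I ^ ℓ).2).mp hc
  obtain ⟨γ, hγ⟩ := h1.principal
  have hγ' : (I : Ideal (𝓞 K)) ^ ℓ = Ideal.span {γ} := by simpa using hγ
  refine ⟨I, γ, ?_, rfl, hγ'⟩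
  rintro rfl
  have h2 : (I : Ideal (𝓞 K)) ^ ℓ ≠ 0 := pow_ne_zero _ (nonZeroDivisors.ne_zero I.2)
  exact h2 (by simpa using hγ')

/-- Every ideal with prescribed positive weights at the infinite places, suitably normalised, is
equivalent to an integral ideal of norm at most `2 √D_K`. -/
theorem exists_reduced_ideal (A : Ideal (𝓞 K)) (hA : A ≠ ⊥) (g : InfinitePlace K → ℝ)
    (hg : ∀ w, 0 < g w)
    (h : ∏ w, g w ^ mult w = 2 * √(absDiscr K) / (Ideal.absNorm A : ℝ)) :
    ∃ (β : K) (J : Ideal (𝓞 K)), β ≠ 0 ∧ J ≠ ⊥ ∧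
      FractionalIdeal.spanSingleton (𝓞 K)⁰ β * (A : FractionalIdeal (𝓞 K)⁰ K) = J ∧
      (∀ w : InfinitePlace K, w β < g w) ∧
      ∏ w, (w β / g w) ^ mult w = (Ideal.absNorm J : ℝ) / (2 * √(absDiscr K)) := by
  have hA' : (A : FractionalIdeal (𝓞 K)⁰ K) ≠ 0 := by simpa using hA
  have hNA : (Ideal.absNorm A : ℝ) ≠ 0 := by
    exact_mod_cast mt Ideal.absNorm_eq_zero_iff.mp hA
  have hZ : 2 * √(absDiscr K) ≠ 0 := by
    have := Real.sqrt_pos.mpr (lt_of_lt_of_le one_pos (one_le_absDiscr (K := K)))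
    positivity
  obtain ⟨β, hβA, hβ, hβg⟩ := exists_ne_zero_mem_fractionalIdeal_lt (Units.mk0 _ hA')⁻¹ g hg (by
    rw [h]
    simp [FractionalIdeal.coeIdeal_absNorm, div_eq_mul_inv])
  have hle : FractionalIdeal.spanSingleton (𝓞 K)⁰ β * (A : FractionalIdeal (𝓞 K)⁰ K) ≤ 1 := by
    have h1 : FractionalIdeal.spanSingleton (𝓞 K)⁰ β ≤ (A : FractionalIdeal (𝓞 K)⁰ K)⁻¹ := by
      rw [FractionalIdeal.spanSingleton_le_iff_mem]
      simpa using hβA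
    calc _ ≤ (A : FractionalIdeal (𝓞 K)⁰ K)⁻¹ * A := by gcongr
      _ = 1 := inv_mul_cancel₀ hA'
  obtain ⟨J, hJ⟩ := FractionalIdeal.le_one_iff_exists_coeIdeal.mp hle
  refine ⟨β, J, hβ, ?_, hJ.symm, hβg, ?_⟩
  · rintro rfl
    rw [FractionalIdeal.coeIdeal_bot, eq_comm, mul_eq_zero] at hJ
    simp only [hA', or_false] at hJ
    exact hβ (FractionalIdeal.spanSingleton_eq_zero_iff.mp hJ)
  · have hN : (Ideal.absNorm J : ℝ) = (∏ w, w β ^ mult w) * Ideal.absNorm A := by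
      rw [prod_eq_abs_norm]
      have := congrArg FractionalIdeal.absNorm hJ
      rw [map_mul, FractionalIdeal.absNorm_span_singleton, FractionalIdeal.coeIdeal_absNorm,
        FractionalIdeal.coeIdeal_absNorm] at this
      exact_mod_cast this
    simp_rw [div_pow]
    rw [Finset.prod_div_distrib, h, hN]
    field_simp

/-- The weights at the infinite places that turn an `ℓ`-torsion ideal class, represented by `I`
with `I ^ ℓ = (γ)`, into an `ℓ`-torsion Arakelov class, multiplied by the class of `P` with its
norm distributed evenly over the infinite places. -/
theorem exists_weights {ℓ : ℕ} (hℓ : 1 ≤ ℓ) (I P : Ideal (𝓞 K)) (hI : I ≠ ⊥) (hP : P ≠ ⊥)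
    (γ : 𝓞 K) (hγ : γ ≠ 0) (h : I ^ ℓ = Ideal.span {γ}) (Z : ℝ) (hZ : 0 < Z) :
    ∃ g : InfinitePlace K → ℝ, (∀ w, 0 < g w) ∧
      (∏ w, g w ^ mult w = Z / (Ideal.absNorm (I * P) : ℝ)) ∧
      ∀ w : InfinitePlace K, g w ^ ℓ * w (γ : K) =
        (Z / Ideal.absNorm P) ^ ((ℓ : ℝ) / Module.finrank ℚ K) := by
  have hℓ0 : ℓ ≠ 0 := by omega
  have hγw (w : InfinitePlace K) : 0 < w (γ : K) := by
    rw [InfinitePlace.pos_iff]; exact_mod_cast hγ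
  have hNP : 0 < (Ideal.absNorm P : ℝ) := by
    exact_mod_cast Nat.pos_of_ne_zero (mt Ideal.absNorm_eq_zero_iff.mp hP)
  have hNI : 0 < (Ideal.absNorm I : ℝ) := by
    exact_mod_cast Nat.pos_of_ne_zero (mt Ideal.absNorm_eq_zero_iff.mp hI)
  have hn : (Module.finrank ℚ K : ℝ) ≠ 0 := by exact_mod_cast Module.finrank_pos.ne'
  have hB : 0 < (Z / Ideal.absNorm P) ^ ((ℓ : ℝ) / Module.finrank ℚ K) := by positivity
  set B := (Z / Ideal.absNorm P) ^ ((ℓ : ℝ) / Module.finrank ℚ K) with hBdef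
  have hpow (w : InfinitePlace K) : ((B / w (γ : K)) ^ (ℓ : ℝ)⁻¹) ^ ℓ = B / w (γ : K) :=
    Real.rpow_inv_natCast_pow (by have := hγw w; positivity) hℓ0
  have hpos (w : InfinitePlace K) : 0 < (B / w (γ : K)) ^ (ℓ : ℝ)⁻¹ := by
    have := hγw w; positivity
  refine ⟨fun w ↦ (B / w (γ : K)) ^ (ℓ : ℝ)⁻¹, hpos, ?_, fun w ↦ ?_⟩
  · refine (pow_left_inj₀ (Finset.prod_nonneg fun w _ ↦ (pow_pos (hpos w) _).le)
      (by positivity) hℓ0).mp ?_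
    rw [← Finset.prod_pow]
    simp_rw [← pow_mul, mul_comm (mult _) ℓ, pow_mul, hpow, div_pow]
    rw [Finset.prod_div_distrib, prod_eq_abs_norm, Finset.prod_pow_eq_pow_sum, sum_mult_eq,
      map_mul]
    have h1 : ((|Algebra.norm ℚ (γ : K)| : ℚ) : ℝ) = (Ideal.absNorm I : ℝ) ^ ℓ := by
      have h2 := congrArg Ideal.absNorm h
      rw [map_pow, Ideal.absNorm_span_singleton] at h2
      rw [← Algebra.coe_norm_int]
      push_cast
      rw [← Nat.cast_pow, h2, Nat.cast_natAbs]
      simp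
    rw [h1, hBdef, ← Real.rpow_natCast, ← Real.rpow_mul (by positivity), div_mul_cancel₀ _ hn,
      Real.rpow_natCast, div_pow]
    push_cast
    rw [mul_pow]
    field_simp
  · simp only
    rw [hpow, div_mul_cancel₀ _ (hγw w).ne']

end Reduction

section Injection

open NumberField.InfinitePlace

variable {K : Type*} [Field K] [NumberField K]

theorem neg_log_le_of_prod_ge (u : InfinitePlace K → ℝ) (hu0 : ∀ w, 0 < u w) (hu1 : ∀ w, u w < 1)
    (Z : ℝ) (hZ : 0 < Z) (h : 1 / Z ≤ ∏ w, u w ^ mult w) (w : InfinitePlace K) :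
    -Real.log (u w) ≤ Real.log Z := by
  classical
  have h1 : ∏ v, u v ^ mult v ≤ u w := by
    rw [← Finset.mul_prod_erase _ _ (Finset.mem_univ w)]
    calc _ ≤ u w * 1 := by
          refine mul_le_mul ?_ (Finset.prod_le_one (fun v _ ↦ pow_nonneg (hu0 v).le _)
            fun v _ ↦ pow_le_one₀ (hu0 v).le (hu1 v).le)
            (Finset.prod_nonneg fun v _ ↦ pow_nonneg (hu0 v).le _) (hu0 w).le
          exact pow_le_of_le_one (hu0 w).le (hu1 w).le mult_ne_zero
      _ = u w := mul_one _
  have h2 := Real.log_le_log (by positivity) (h.trans h1)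
  rw [one_div, Real.log_inv] at h2
  linarith

theorem div_le_exp_one_of_floor_eq {a b : ℝ} (ha : 0 < a) (hb : 0 < b) (hb1 : b < 1)
    (h : ⌊-Real.log a⌋₊ = ⌊-Real.log b⌋₊) : b / a ≤ Real.exp 1 := by
  have h1 : 0 ≤ -Real.log b := by have := Real.log_neg hb hb1; linarith
  have h2 := Nat.lt_floor_add_one (-Real.log a)
  have h3 := Nat.floor_le h1
  rw [h] at h2
  rw [← Real.log_le_iff_le_exp (by positivity), Real.log_div hb.ne' ha.ne']
  linarith

/-- If `β I P` and `β' I' P'` are the same ideal, where `I ^ ℓ = (γ)` and `I' ^ ℓ = (γ')`, then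
`(P P'⁻¹) ^ ℓ` is principal. -/
theorem spanSingleton_eq_of_reduced_eq {ℓ : ℕ} {I I' P P' : Ideal (𝓞 K)} {γ γ' : 𝓞 K} {β β' : K}
    (hP' : P' ≠ ⊥) (hγ : γ ≠ 0) (hβ : β ≠ 0)
    (h : I ^ ℓ = Ideal.span {γ}) (h' : I' ^ ℓ = Ideal.span {γ'})
    (hJ : FractionalIdeal.spanSingleton (𝓞 K)⁰ β * ((I * P : Ideal (𝓞 K)) :
        FractionalIdeal (𝓞 K)⁰ K) =
      FractionalIdeal.spanSingleton (𝓞 K)⁰ β' * ((I' * P' : Ideal (𝓞 K)) :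
        FractionalIdeal (𝓞 K)⁰ K)) :
    FractionalIdeal.spanSingleton (𝓞 K)⁰ ((β' / β) ^ ℓ * ((γ' : K) / (γ : K))) =
      ((P : FractionalIdeal (𝓞 K)⁰ K) * (P' : FractionalIdeal (𝓞 K)⁰ K)⁻¹) ^ ℓ := by
  have hP0 : (P' : FractionalIdeal (𝓞 K)⁰ K) ≠ 0 := by simpa using hP'
  have hs (I : Ideal (𝓞 K)) (γ : 𝓞 K) (h : I ^ ℓ = Ideal.span {γ}) :
      (I : FractionalIdeal (𝓞 K)⁰ K) ^ ℓ = FractionalIdeal.spanSingleton (𝓞 K)⁰ (γ : K) := by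
    rw [← FractionalIdeal.coeIdeal_pow, h, FractionalIdeal.coeIdeal_span_singleton]
  have h1 := congrArg (· ^ ℓ) hJ
  simp only [FractionalIdeal.coeIdeal_mul, mul_pow, hs I γ h, hs I' γ' h',
    FractionalIdeal.spanSingleton_pow] at h1
  rw [← mul_assoc, ← mul_assoc, FractionalIdeal.spanSingleton_mul_spanSingleton,
    FractionalIdeal.spanSingleton_mul_spanSingleton] at h1
  have hγK : (γ : K) ≠ 0 := by exact_mod_cast hγ
  have hα : (β' / β) ^ ℓ * ((γ' : K) / (γ : K)) = (β' ^ ℓ * γ') * (β ^ ℓ * γ)⁻¹ := by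
    rw [div_pow]; field_simp
  have h0 : FractionalIdeal.spanSingleton (𝓞 K)⁰ (β ^ ℓ * (γ : K)) ≠ 0 := by
    rw [Ne, FractionalIdeal.spanSingleton_eq_zero_iff]
    positivity
  rw [hα, ← FractionalIdeal.spanSingleton_mul_spanSingleton, ← FractionalIdeal.spanSingleton_inv,
    mul_pow, inv_pow, eq_mul_inv_iff_mul_eq₀ (pow_ne_zero _ hP0), mul_right_comm,
    mul_inv_eq_iff_eq_mul₀ h0, ← h1, mul_comm]

theorem mk0_eq_of_spanSingleton_mul_eq {I I' P : Ideal (𝓞 K)} (hI : I ∈ (Ideal (𝓞 K))⁰)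
    (hI' : I' ∈ (Ideal (𝓞 K))⁰) (hP : P ≠ ⊥) {β β' : K} (hβ : β ≠ 0) (hβ' : β' ≠ 0)
    (hJ : FractionalIdeal.spanSingleton (𝓞 K)⁰ β * ((I * P : Ideal (𝓞 K)) :
        FractionalIdeal (𝓞 K)⁰ K) =
      FractionalIdeal.spanSingleton (𝓞 K)⁰ β' * ((I' * P : Ideal (𝓞 K)) :
        FractionalIdeal (𝓞 K)⁰ K)) :
    ClassGroup.mk0 ⟨I, hI⟩ = ClassGroup.mk0 ⟨I', hI'⟩ := by
  have hP0 : (P : FractionalIdeal (𝓞 K)⁰ K) ≠ 0 := by simpa using hP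
  have h0 : FractionalIdeal.spanSingleton (𝓞 K)⁰ β' ≠ 0 := by
    rwa [Ne, FractionalIdeal.spanSingleton_eq_zero_iff]
  rw [ClassGroup.mk0_eq_mk0_iff_exists_fraction_ring K]
  refine ⟨β / β', div_ne_zero hβ hβ', ?_⟩
  rw [FractionalIdeal.coeIdeal_mul, FractionalIdeal.coeIdeal_mul, ← mul_assoc, ← mul_assoc,
    mul_left_inj' hP0] at hJ
  rw [div_eq_mul_inv, ← FractionalIdeal.spanSingleton_mul_spanSingleton,
    ← FractionalIdeal.spanSingleton_inv, mul_comm (FractionalIdeal.spanSingleton _ β), mul_assoc]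
  exact (congrArg _ hJ).trans (inv_mul_cancel_left₀ h0 _)

/-- The main inequality. Attach to an `ℓ`-torsion class `c` and an ideal `P ∈ T` a reduced ideal `J`
in the class of `c P`, together with the logarithms, rounded to integers, of its archimedean
coordinates. If two pairs with `P ≠ Q` had the same image, then `(P Q⁻¹) ^ ℓ` would have a
generator of small archimedean size; if `P = Q`, the classes agree. So the map is injective. -/
theorem classTorsionCard_mul_card_le {ℓ : ℕ} (hℓ : 1 ≤ ℓ) (T : Finset (Ideal (𝓞 K)))
    (hT0 : ∀ P ∈ T, P ≠ ⊥)
    (hT : ∀ P ∈ T, ∀ Q ∈ T, P ≠ Q → ∀ α : K, FractionalIdeal.spanSingleton (𝓞 K)⁰ α =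
      ((P : FractionalIdeal (𝓞 K)⁰ K) * (Q : FractionalIdeal (𝓞 K)⁰ K)⁻¹) ^ ℓ →
      ∃ w : InfinitePlace K, Real.exp ℓ * ((Ideal.absNorm P : ℝ) / Ideal.absNorm Q) ^
        ((ℓ : ℝ) / Module.finrank ℚ K) < w α) :
    (classTorsionCard ℓ K : ℝ) * T.card ≤
      ({J : Ideal (𝓞 K) | J ≠ ⊥ ∧ (Ideal.absNorm J : ℝ) ≤ 2 * √(absDiscr K)}.ncard : ℝ) *
        (Real.log (2 * √(absDiscr K)) + 1) ^ Module.finrank ℚ K := by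
  classical
  set Z := 2 * √(absDiscr K) with hZdef
  have hZ1 : 1 ≤ Z := by
    have := Real.one_le_sqrt.mpr (one_le_absDiscr (K := K))
    linarith
  have hZ : 0 < Z := by linarith
  choose I γ hγ hIc hI using fun c : {c : ClassGroup (𝓞 K) // c ^ ℓ = 1} ↦
    exists_ideal_pow_eq_span c.1 c.2
  have hI0 (c) : (I c : Ideal (𝓞 K)) ≠ ⊥ := nonZeroDivisors.ne_zero (I c).2
  let A := {c : ClassGroup (𝓞 K) // c ^ ℓ = 1} × T
  have hex (a : A) := exists_weights hℓ (I a.1) a.2.1 (hI0 _) (hT0 _ a.2.2) (γ a.1) (hγ _) (hI _)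
    Z hZ
  choose g hg0 hgprod hgpow using hex
  have hex (a : A) := exists_reduced_ideal (I a.1 * a.2.1 : Ideal (𝓞 K))
    (mul_ne_zero (hI0 a.1) (hT0 _ a.2.2)) (g a) (hg0 a) (hgprod a)
  choose β J hβ hJ0 hJ hβg hJN using hex
  let u (a : A) (w : InfinitePlace K) : ℝ := w (β a) / g a w
  have hu0 (a w) : 0 < u a w := div_pos (InfinitePlace.pos_iff.mpr (hβ a)) (hg0 a w)
  have hu1 (a w) : u a w < 1 := (div_lt_one (hg0 a w)).mpr (hβg a w)
  have hJle (a) : (Ideal.absNorm (J a) : ℝ) ≤ Z := by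
    rw [← div_le_one hZ, ← hJN a]
    exact Finset.prod_le_one (fun w _ ↦ (pow_pos (hu0 a w) _).le)
      fun w _ ↦ pow_le_one₀ (hu0 a w).le (hu1 a w).le
  have hJge (a) : 1 / Z ≤ ∏ w, u a w ^ mult w := by
    rw [hJN a]
    gcongr
    exact_mod_cast Nat.one_le_iff_ne_zero.mpr (mt Ideal.absNorm_eq_zero_iff.mp (hJ0 a))
  have hfin := finite_absNorm_le K Z
  let Φ (a : A) : Ideal (𝓞 K) × (InfinitePlace K → ℕ) := (J a, fun w ↦ ⌊-Real.log (u a w)⌋₊)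
  have hinj : Function.Injective Φ := by
    intro a a' haa
    have hJJ : J a = J a' := congrArg Prod.fst haa
    have hcell (w) : ⌊-Real.log (u a w)⌋₊ = ⌊-Real.log (u a' w)⌋₊ :=
      congrFun (congrArg Prod.snd haa) w
    have hprin := (hJ a).trans ((congrArg _ hJJ).trans (hJ a').symm)
    have hPP : a.2.1 = a'.2.1 := by
      by_contra hne
      obtain ⟨w, hw⟩ := hT _ a.2.2 _ a'.2.2 hne _
        (spanSingleton_eq_of_reduced_eq (hT0 _ a'.2.2) (hγ a.1) (hβ a) (hI a.1) (hI a'.1) hprin)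
      refine absurd hw (not_lt.mpr ?_)
      have hNP (a : A) : 0 < (Ideal.absNorm a.2.1 : ℝ) := by
        exact_mod_cast Nat.pos_of_ne_zero (mt Ideal.absNorm_eq_zero_iff.mp (hT0 _ a.2.2))
      have hγw (c) : 0 < w (γ c : K) := by
        rw [InfinitePlace.pos_iff]; exact_mod_cast hγ c
      have hβu (a : A) : w (β a) = u a w * g a w := (div_mul_cancel₀ _ (hg0 a w).ne').symm
      have heq : w ((β a' / β a) ^ ℓ * ((γ a'.1 : K) / (γ a.1 : K))) =
          (u a' w / u a w) ^ ℓ * (((Ideal.absNorm a.2.1 : ℝ) / Ideal.absNorm a'.2.1) ^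
        ((ℓ : ℝ) / Module.finrank ℚ K)) := by
        have h1 : (Ideal.absNorm a.2.1 : ℝ) / Ideal.absNorm a'.2.1 =
          (Z / Ideal.absNorm a'.2.1) / (Z / Ideal.absNorm a.2.1) := by
          have := hNP a; have := hNP a'; field_simp
        rw [h1, Real.div_rpow (by have := hNP a'; positivity) (by have := hNP a; positivity),
          ← hgpow a w, ← hgpow a' w, map_mul, map_pow, map_div₀, map_div₀, hβu, hβu, div_pow, div_pow,
          mul_pow, mul_pow]
        have := hγw a.1; have := hu0 a w; have := hg0 a w
        field_simp
      rw [heq, ← mul_one (ℓ : ℝ), Real.exp_nat_mul, mul_one]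
      have := div_le_exp_one_of_floor_eq (hu0 a w) (hu0 a' w) (hu1 a' w) (hcell w)
      have := hu0 a w; have := hu0 a' w
      gcongr
    refine Prod.ext (Subtype.ext ?_) (Subtype.ext hPP)
    rw [← hPP] at hprin
    rw [← hIc a.1, ← hIc a'.1]
    exact mk0_eq_of_spanSingleton_mul_eq (I a.1).2 (I a'.1).2 (hT0 _ a.2.2) (hβ a) (hβ a') hprin
  have hcard := Finset.card_le_card_of_injOn (s := (Finset.univ : Finset A))
    (t := hfin.toFinset ×ˢ Fintype.piFinset fun _ ↦ Finset.range (⌊Real.log Z⌋₊ + 1)) Φ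
    (fun a _ ↦ by
      simp only [Φ, Finset.coe_product, Set.mem_prod, Finset.mem_coe, Set.Finite.mem_toFinset,
        Fintype.mem_piFinset, Finset.mem_range, Nat.lt_succ_iff]
      exact ⟨⟨hJ0 a, hJle a⟩, fun w ↦ Nat.floor_le_floor
        (neg_log_le_of_prod_ge (u a) (hu0 a) (hu1 a) Z hZ (hJge a) w)⟩)
    hinj.injOn
  have hlog : 0 ≤ Real.log Z := Real.log_nonneg hZ1
  have hplaces : Fintype.card (InfinitePlace K) ≤ Module.finrank ℚ K := by
    rw [← sum_mult_eq, Fintype.card_eq_sum_ones]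
    exact Finset.sum_le_sum fun w _ ↦ mult_pos
  calc (classTorsionCard ℓ K : ℝ) * T.card = ((Finset.univ : Finset A).card : ℝ) := by
        simp [A, classTorsionCard, Fintype.card_prod, Nat.card_eq_fintype_card]
    _ ≤ (hfin.toFinset.card : ℝ) * ((⌊Real.log Z⌋₊ : ℝ) + 1) ^ Fintype.card (InfinitePlace K) := by
        refine (Nat.cast_le.mpr hcard).trans_eq ?_
        simp
    _ ≤ (hfin.toFinset.card : ℝ) * (Real.log Z + 1) ^ Module.finrank ℚ K := by
        gcongr
        calc _ ≤ (Real.log Z + 1) ^ Fintype.card (InfinitePlace K) := by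
              gcongr
              exact Nat.floor_le hlog
          _ ≤ _ := pow_le_pow_right₀ (by linarith) hplaces
    _ = _ := by rw [Set.ncard_eq_toFinset_card _ hfin]

end Injection

/-! ### Heights of generators of `(P Q⁻¹) ^ ℓ` -/

section Heights

open NumberField.InfinitePlace

variable {K : Type*} [Field K] [NumberField K]

theorem finitePlace_mul_le_one {ℓ : ℕ} {P Q : Ideal (𝓞 K)} (hQ : Q ≠ ⊥) {α : K}
    (hα : FractionalIdeal.spanSingleton (𝓞 K)⁰ α =
      ((P : FractionalIdeal (𝓞 K)⁰ K) * (Q : FractionalIdeal (𝓞 K)⁰ K)⁻¹) ^ ℓ)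
    (v : FinitePlace K) {b : 𝓞 K} (hb : b ∈ Q ^ ℓ) : v α * v (b : K) ≤ 1 := by
  have hQ0 : (Q : FractionalIdeal (𝓞 K)⁰ K) ≠ 0 := by simpa using hQ
  have h1 : FractionalIdeal.spanSingleton (𝓞 K)⁰ α * ((Q ^ ℓ : Ideal (𝓞 K)) :
      FractionalIdeal (𝓞 K)⁰ K) = ((P ^ ℓ : Ideal (𝓞 K)) : FractionalIdeal (𝓞 K)⁰ K) := by
    rw [hα, FractionalIdeal.coeIdeal_pow, FractionalIdeal.coeIdeal_pow, ← mul_pow,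
      inv_mul_cancel_right₀ hQ0]
  have h2 : α * (b : K) ∈ ((P ^ ℓ : Ideal (𝓞 K)) : FractionalIdeal (𝓞 K)⁰ K) := by
    rw [← h1]
    exact FractionalIdeal.mul_mem_mul (FractionalIdeal.mem_spanSingleton_self _ α)
      (FractionalIdeal.mem_coeIdeal_of_mem _ hb)
  obtain ⟨c, -, hc⟩ := (FractionalIdeal.mem_coeIdeal _).mp h2
  rw [← map_mul, ← hc, ← FinitePlace.norm_embedding_eq]
  exact FinitePlace.norm_le_one K _ c

theorem finitePlace_le_one_of_ne {ℓ : ℕ} {P Q : Ideal (𝓞 K)} (hQ : Q ≠ ⊥) [hQp : Q.IsPrime] {α : K}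
    (hα : FractionalIdeal.spanSingleton (𝓞 K)⁰ α =
      ((P : FractionalIdeal (𝓞 K)⁰ K) * (Q : FractionalIdeal (𝓞 K)⁰ K)⁻¹) ^ ℓ)
    (v : FinitePlace K) (hv : v.maximalIdeal.asIdeal ≠ Q) : v α ≤ 1 := by
  have hnle : ¬ Q ^ ℓ ≤ v.maximalIdeal.asIdeal := fun h ↦ by
    have h1 : Q ≤ v.maximalIdeal.asIdeal := v.maximalIdeal.isPrime.le_of_pow_le h
    exact hv ((hQp.isMaximal hQ).eq_of_le v.maximalIdeal.isPrime.ne_top h1).symm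
  obtain ⟨b, hb, hbv⟩ := SetLike.not_le_iff_exists.mp hnle
  have h1 := finitePlace_mul_le_one hQ hα v hb
  have h2 : v (b : K) = 1 := by
    rw [← FinitePlace.norm_embedding_eq]
    exact (FinitePlace.norm_eq_one_iff_notMem K _ b).mpr hbv
  rwa [h2, mul_one] at h1

theorem finitePlace_le_absNorm_pow {ℓ : ℕ} {P Q : Ideal (𝓞 K)} (hQ : Q ≠ ⊥) [hQp : Q.IsPrime]
    {α : K} (hα : FractionalIdeal.spanSingleton (𝓞 K)⁰ α =
      ((P : FractionalIdeal (𝓞 K)⁰ K) * (Q : FractionalIdeal (𝓞 K)⁰ K)⁻¹) ^ ℓ)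
    (v : FinitePlace K) (hv : v.maximalIdeal.asIdeal = Q) :
    v α ≤ (Ideal.absNorm Q : ℝ) ^ ℓ := by
  obtain ⟨b, hb, hbn⟩ := Ideal.exists_mem_pow_notMem_pow_succ Q hQ hQp.ne_top ℓ
  have hb0 : b ≠ 0 := by
    rintro rfl
    exact hbn (Submodule.zero_mem _)
  have h1 := finitePlace_mul_le_one hQ hα v hb
  have h2 := FinitePlace.apply_mul_absNorm_pow_eq_one v hb0
  have h3 : multiplicity v.maximalIdeal.asIdeal (Ideal.span {b}) = ℓ := by
    rw [hv]
    refine multiplicity_eq_of_dvd_of_not_dvd ?_ ?_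
    · rwa [Ideal.dvd_span_singleton]
    · rwa [Ideal.dvd_span_singleton]
  rw [h3, hv] at h2
  have hvb : 0 < v (b : K) := FinitePlace.pos_iff.mpr (by exact_mod_cast hb0)
  refine le_of_mul_le_mul_right ?_ hvb
  rw [mul_comm ((Ideal.absNorm Q : ℝ) ^ ℓ), h2]
  exact h1

theorem mulHeight₁_le_of_spanSingleton_eq {ℓ : ℕ} {P Q : Ideal (𝓞 K)} (hP : P ≠ ⊥) (hQ : Q ≠ ⊥)
    [Q.IsPrime] {α : K} (hα : FractionalIdeal.spanSingleton (𝓞 K)⁰ α =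
      ((P : FractionalIdeal (𝓞 K)⁰ K) * (Q : FractionalIdeal (𝓞 K)⁰ K)⁻¹) ^ ℓ)
    (h : ∀ w : InfinitePlace K, w α ≤ Real.exp ℓ *
      ((Ideal.absNorm P : ℝ) / Ideal.absNorm Q) ^ ((ℓ : ℝ) / Module.finrank ℚ K)) :
    Height.mulHeight₁ α ≤ Real.exp (ℓ * Module.finrank ℚ K : ℕ) *
      (max (Ideal.absNorm P : ℝ) (Ideal.absNorm Q)) ^ ℓ := by
  have hNP : 0 < (Ideal.absNorm P : ℝ) := by
    exact_mod_cast Nat.pos_of_ne_zero (mt Ideal.absNorm_eq_zero_iff.mp hP)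
  have hNQ : 0 < (Ideal.absNorm Q : ℝ) := by
    exact_mod_cast Nat.pos_of_ne_zero (mt Ideal.absNorm_eq_zero_iff.mp hQ)
  have hNQ1 : 1 ≤ (Ideal.absNorm Q : ℝ) := by
    exact_mod_cast Nat.one_le_iff_ne_zero.mpr (mt Ideal.absNorm_eq_zero_iff.mp hQ)
  have hn : (Module.finrank ℚ K : ℝ) ≠ 0 := by exact_mod_cast Module.finrank_pos.ne'
  set m := max 1 ((Ideal.absNorm P : ℝ) / Ideal.absNorm Q) with hm
  have hm1 : 1 ≤ m := le_max_left _ _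
  have hfin : ∏ᶠ v : FinitePlace K, max (v α) 1 ≤ (Ideal.absNorm Q : ℝ) ^ ℓ := by
    let v₀ : FinitePlace K := FinitePlace.mk ⟨Q, inferInstance, hQ⟩
    -- Since `α Q ^ ℓ` is integral, only the place of `Q` can contribute.
    rw [finprod_eq_single _ v₀]
    · refine max_le (finitePlace_le_absNorm_pow hQ hα v₀ ?_) (one_le_pow₀ hNQ1)
      exact congrArg _ (FinitePlace.maximalIdeal_mk _)
    · intro v hv
      refine max_eq_right (finitePlace_le_one_of_ne hQ hα v fun h ↦ hv ?_)
      rw [← FinitePlace.mk_maximalIdeal v, FinitePlace.mk_eq_iff]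
      exact IsDedekindDomain.HeightOneSpectrum.ext h
  have hinf : ∏ w : InfinitePlace K, max (w α) 1 ^ mult w ≤
      Real.exp (ℓ * Module.finrank ℚ K : ℕ) * m ^ ℓ := by
    calc ∏ w : InfinitePlace K, max (w α) 1 ^ mult w
        ≤ ∏ w : InfinitePlace K, (Real.exp ℓ * m ^ ((ℓ : ℝ) / Module.finrank ℚ K)) ^ mult w := by
          refine Finset.prod_le_prod (fun w _ ↦ by positivity) fun w _ ↦ ?_
          refine pow_le_pow_left₀ (by positivity) (max_le ((h w).trans ?_) ?_) _
          · gcongr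
            exact le_max_right _ _
          · exact one_le_mul_of_one_le_of_one_le (Real.one_le_exp (by positivity))
              (Real.one_le_rpow hm1 (by positivity))
      _ = _ := by
          rw [Finset.prod_pow_eq_pow_sum, sum_mult_eq, mul_pow, ← Real.exp_nat_mul,
            ← Real.rpow_natCast, ← Real.rpow_mul (by positivity), div_mul_cancel₀ _ hn,
            Real.rpow_natCast]
          push_cast
          ring_nf
  rw [NumberField.mulHeight₁_eq]
  calc _ ≤ Real.exp (ℓ * Module.finrank ℚ K : ℕ) * m ^ ℓ * (Ideal.absNorm Q : ℝ) ^ ℓ := by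
        refine mul_le_mul hinf hfin (finprod_nonneg fun v ↦ ?_) (by positivity)
        exact le_max_of_le_right zero_le_one
    _ = _ := by
        rw [mul_assoc, ← mul_pow, hm, max_mul_of_nonneg _ _ hNQ.le, one_mul,
          div_mul_cancel₀ _ hNQ.ne', max_comm]

end Heights

/-! ### Torsion bounds from split primes and the invariant `η_ℓ` -/

section SplitPrimes

variable {K : Type*} [Field K] [NumberField K]

theorem etaInvariant_le {ℓ : ℕ} {α : K} {P Q : Ideal (𝓞 K)} (hPQ : P ≠ Q)
    (hP : IsDegreeOneUnramified P) (hQ : IsDegreeOneUnramified Q)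
    (hα : FractionalIdeal.spanSingleton (𝓞 K)⁰ α =
      ((P : FractionalIdeal (𝓞 K)⁰ K) * (Q : FractionalIdeal (𝓞 K)⁰ K)⁻¹) ^ ℓ) :
    etaInvariant ℓ K ≤ Height.mulHeight₁ α := by
  refine csInf_le ⟨0, ?_⟩ ⟨α, P, Q, hPQ, hP, hQ, hα, rfl⟩
  rintro _ ⟨β, -, -, -, -, -, -, rfl⟩
  exact Height.mulHeight₁_nonneg β

variable (K) in
/-- One prime of `𝓞 K` above each rational prime `p ≤ Y` that splits completely. -/
theorem exists_finset_degreeOne (Y : ℝ) :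
    ∃ T : Finset (Ideal (𝓞 K)), T.card = numSplitPrimes K Y ∧
      ∀ P ∈ T, IsDegreeOneUnramified P ∧ (Ideal.absNorm P : ℝ) ≤ Y := by
  classical
  have hfin : {p : ℕ | p.Prime ∧ (p : ℝ) ≤ Y ∧ SplitsCompletelyIn p K}.Finite :=
    (Set.finite_Iic ⌊Y⌋₊).subset fun p hp ↦ Nat.le_floor hp.2.1
  have hex (p : ℕ) : ∃ P : Ideal (𝓞 K), p.Prime ∧ SplitsCompletelyIn p K →
      IsDegreeOneUnramified P ∧ Ideal.absNorm P = p := by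
    by_cases hp : p.Prime ∧ SplitsCompletelyIn p K
    · have hpp : (Ideal.span {(p : ℤ)}).IsPrime := by
        rw [Ideal.span_singleton_prime (by exact_mod_cast hp.1.ne_zero)]
        exact Nat.prime_iff_prime_int.mp hp.1
      obtain ⟨⟨P, hPp, hPo⟩⟩ := Ideal.nonempty_primesOver (P := Ideal.span {(p : ℤ)}) (S := 𝓞 K)
      have hsplit := hp.2 P hPp hPo
      have hN := Ideal.pow_inertiaDeg p P
      rw [hsplit.2, pow_one] at hN
      refine ⟨P, fun _ ↦ ⟨⟨hPp, ?_, hsplit⟩, hN.symm⟩⟩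
      rintro rfl
      simp only [Ideal.absNorm_bot] at hN
      exact hp.1.ne_zero hN
    · exact ⟨⊥, fun h ↦ (hp h).elim⟩
  choose P hP using hex
  refine ⟨hfin.toFinset.image P, ?_, ?_⟩
  · rw [Finset.card_image_of_injOn, numSplitPrimes, Set.ncard_eq_toFinset_card _ hfin]
    intro p hp q hq hpq
    simp only [Set.Finite.coe_toFinset, Set.mem_ofPred_eq] at hp hq
    rw [← (hP p ⟨hp.1, hp.2.2⟩).2, ← (hP q ⟨hq.1, hq.2.2⟩).2, hpq]
  · intro Q hQ
    obtain ⟨p, hp, rfl⟩ := Finset.mem_image.mp hQ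
    simp only [Set.Finite.mem_toFinset, Set.mem_ofPred_eq] at hp
    have := hP p ⟨hp.1, hp.2.2⟩
    exact ⟨this.1, by rw [this.2]; exact hp.2.1⟩

/-- A bound, uniform in the fields of degree `d`, for the number of values of the map in
`classTorsionCard_mul_card_le`. -/
theorem exists_reducedCount_le (d : ℕ) (hd : 1 ≤ d) (ε : ℝ) (hε : 0 < ε) :
    ∃ C : ℝ, 0 < C ∧ ∀ (K : Type) [Field K] [NumberField K], Module.finrank ℚ K = d →
      ∀ X : ℝ, absDiscr K ≤ 2 * X →
      ({J : Ideal (𝓞 K) | J ≠ ⊥ ∧ (Ideal.absNorm J : ℝ) ≤ 2 * √(absDiscr K)}.ncard : ℝ) *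
        (Real.log (2 * √(absDiscr K)) + 1) ^ Module.finrank ℚ K ≤ C * X ^ (1 / 2 + ε) := by
  have hd0 : (0 : ℝ) < d := by exact_mod_cast hd
  set ζ : ℝ := ∑' m : ℕ, ((m : ℝ) ^ (1 + ε))⁻¹ with hζ
  have hζ0 : 0 < ζ := by
    have hsum : Summable fun m : ℕ ↦ ((m : ℝ) ^ (1 + ε))⁻¹ :=
      Real.summable_nat_rpow_inv.mpr (by linarith)
    exact hsum.tsum_pos (fun m ↦ by positivity) 1 (by simp)
  refine ⟨ζ ^ d * (d / ε + 1) ^ d * (2 * √2) ^ (1 + 2 * ε), by positivity, ?_⟩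
  intro K _ _ hK X hX
  have hD := one_le_absDiscr (K := K)
  have hX0 : 0 < X := by linarith
  set Z := 2 * √(absDiscr K) with hZ
  have hZ1 : 1 ≤ Z := by
    have := Real.one_le_sqrt.mpr hD
    linarith
  have hlog : 0 ≤ Real.log Z := Real.log_nonneg hZ1
  have h1 := ncard_absNorm_le K Z (by linarith) (1 + ε) (by linarith)
  rw [hK] at h1 ⊢
  have h2 : Real.log Z + 1 ≤ (d / ε + 1) * Z ^ (ε / d) := by
    have h3 := Real.log_le_rpow_div (x := Z) (by linarith) (ε := ε / d) (by positivity)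
    have h4 : 1 ≤ Z ^ (ε / d) := Real.one_le_rpow hZ1 (by positivity)
    have h5 : Z ^ (ε / d) / (ε / d) = d / ε * Z ^ (ε / d) := by field_simp
    rw [h5] at h3
    linarith
  calc _ ≤ (Z ^ (1 + ε) * ζ ^ d) * ((d / ε + 1) * Z ^ (ε / d)) ^ d := by gcongr
    _ = ζ ^ d * (d / ε + 1) ^ d * Z ^ (1 + 2 * ε) := by
      rw [mul_pow, ← Real.rpow_mul_natCast (by linarith), div_mul_cancel₀ _ hd0.ne',
        show 1 + 2 * ε = (1 + ε) + ε by ring, Real.rpow_add (by linarith) (1 + ε) ε]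
      ring
    _ ≤ ζ ^ d * (d / ε + 1) ^ d * (2 * √(2 * X)) ^ (1 + 2 * ε) := by
      rw [hZ]
      gcongr
    _ = ζ ^ d * (d / ε + 1) ^ d * (2 * √2) ^ (1 + 2 * ε) * X ^ (1 / 2 + ε) := by
      rw [Real.sqrt_mul zero_le_two, ← mul_assoc, Real.mul_rpow (by positivity) (by positivity),
        Real.sqrt_eq_rpow X, ← Real.rpow_mul hX0.le]
      ring_nf

/-- The trivial bound for `#Cl_K[ℓ]`, and its improvement by the number of split primes `p ≤ Y`, of
Ellenberg--Venkatesh type: the condition that the primes be small relative to `D_K` is replaced by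
one relative to `η_ℓ(K)`. -/
theorem exists_classTorsionCard_le (d ℓ : ℕ) (hd : 1 ≤ d) (hℓ : 1 ≤ ℓ) (ε : ℝ) (hε : 0 < ε) :
    ∃ C : ℝ, 0 < C ∧ ∀ (K : Type) [Field K] [NumberField K], Module.finrank ℚ K = d →
      ∀ X : ℝ, absDiscr K ≤ 2 * X →
        (classTorsionCard ℓ K : ℝ) ≤ C * X ^ (1 / 2 + ε) ∧
        ∀ Y : ℝ, 0 ≤ Y → Real.exp (ℓ * d : ℕ) * Y ^ ℓ < etaInvariant ℓ K →
          (classTorsionCard ℓ K : ℝ) * numSplitPrimes K Y ≤ C * X ^ (1 / 2 + ε) := by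
  obtain ⟨C, hC, h⟩ := exists_reducedCount_le d hd ε hε
  refine ⟨C, hC, fun K _ _ hK X hX ↦ ⟨?_, fun Y hY hη ↦ ?_⟩⟩
  · -- The unit ideal alone satisfies the hypotheses without any condition on `η_ℓ`.
    have h1 := classTorsionCard_mul_card_le (K := K) hℓ {⊤} (by simp) (by simp)
    simp only [Finset.card_singleton, Nat.cast_one, mul_one] at h1
    exact h1.trans (h K hK X hX)
  · obtain ⟨T, hTcard, hT⟩ := exists_finset_degreeOne K Y
    rw [← hTcard]
    refine (classTorsionCard_mul_card_le hℓ T (fun P hP ↦ (hT P hP).1.2.1) ?_).trans (h K hK X hX)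
    intro P hP Q hQ hPQ α hα
    by_contra! hw
    have := (hT Q hQ).1.1
    have h1 := mulHeight₁_le_of_spanSingleton_eq (hT P hP).1.2.1 (hT Q hQ).1.2.1 hα hw
    have h2 := etaInvariant_le hPQ (hT P hP).1 (hT Q hQ).1 hα
    rw [hK] at h1
    have h3 : Real.exp (ℓ * d : ℕ) * (max (Ideal.absNorm P : ℝ) (Ideal.absNorm Q)) ^ ℓ ≤
        Real.exp (ℓ * d : ℕ) * Y ^ ℓ := by
      gcongr
      exact max_le (hT P hP).2 (hT Q hQ).2
    linarith

end SplitPrimes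

/-! ### Averaging over the family -/

section Averaging

theorem le_of_mul_splitCount_le {h M C c X δ ε : ℝ} (hh : 0 ≤ h) (hC : 0 ≤ C) (hc : 0 < c)
    (hX : 2 ≤ X) (hε : 0 < ε) (hM : c * X ^ δ / Real.log X < M)
    (hhM : h * M ≤ C * X ^ (1 / 2 + ε)) : h ≤ C / (c * ε) * X ^ (1 / 2 + 2 * ε - δ) := by
  have hX0 : 0 < X := by linarith
  have hlog : 0 < Real.log X := Real.log_pos (by linarith)
  have h1 : h * (c * X ^ δ / Real.log X) ≤ C * X ^ (1 / 2 + ε) :=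
    (mul_le_mul_of_nonneg_left hM.le hh).trans hhM
  have h2 : h ≤ C * X ^ (1 / 2 + ε) * (Real.log X / (c * X ^ δ)) := by
    have h3 : h = h * (c * X ^ δ / Real.log X) * (Real.log X / (c * X ^ δ)) := by field_simp
    rw [h3]
    gcongr
  refine h2.trans ?_
  have h4 : Real.log X ≤ X ^ ε / ε := Real.log_le_rpow_div hX0.le hε
  calc _ ≤ C * X ^ (1 / 2 + ε) * (X ^ ε / ε / (c * X ^ δ)) := by gcongr
    _ = C / (c * ε) * (X ^ (1 / 2 + ε) * X ^ ε / X ^ δ) := by field_simp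
    _ = _ := by
      rw [← Real.rpow_add hX0, ← Real.rpow_sub hX0]
      ring_nf

/-- On a level with `η_ℓ ≍ X ^ (ℓ δ)`, `δ = t ρ / (ℓ θ)`, the exponent is linear in `t ∈ [0, 1]`,
hence at most its value at one of the end points. -/
theorem rpow_level_le {k ρ Θ τ ε ε₁ r t X : ℝ} (hΘ : 0 < Θ) (hτ : 0 ≤ τ)
    (hX : 2 ≤ X) (hε : 0 < ε) (hε₁ : k * (2 * ε₁) ≤ ε / 4) (hr : r ≤ ε / 4) (ht0 : 0 ≤ t)
    (ht1 : t ≤ 1) :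
    X ^ (Θ * (t * (ρ / Θ)) + r) * X ^ (k * (1 / 2 + 2 * ε₁ - t * (ρ / Θ))) ≤
      X ^ (k / 2 + ρ - ρ * k / Θ + ε) + X ^ (k / 2 + τ + ε) := by
  have hX0 : 0 < X := by linarith
  rw [← Real.rpow_add hX0]
  have h1 : Θ * (t * (ρ / Θ)) + r + k * (1 / 2 + 2 * ε₁ - t * (ρ / Θ)) =
      k / 2 + t * (ρ - ρ * k / Θ) + (r + k * (2 * ε₁)) := by
    field_simp
    ring
  rw [h1]
  rcases le_total 0 (ρ - ρ * k / Θ) with h | h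
  · refine (Real.rpow_le_rpow_of_exponent_le (by linarith) ?_).trans
      (le_add_of_nonneg_right (by positivity))
    have := mul_le_of_le_one_left h ht1
    linarith
  · refine (Real.rpow_le_rpow_of_exponent_le (by linarith) ?_).trans
      (le_add_of_nonneg_left (by positivity))
    have := mul_nonpos_of_nonneg_of_nonpos ht0 h
    linarith

/-- A sum over `F` is at most the sum over a covering of `F`, estimated by cardinality times
maximum on each member. -/
theorem sum_le_of_cover {ι κ : Type*} (F : Finset ι) (f : ι → ℝ) (hf : ∀ x, 0 ≤ f x) (T : Finset κ)
    (G : κ → Set ι) (hG : ∀ x ∈ F, ∃ j ∈ T, x ∈ G j) (hGfin : ∀ j, (G j).Finite) (b n : κ → ℝ)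
    (hb0 : ∀ j ∈ T, 0 ≤ b j) (hb : ∀ j ∈ T, ∀ x ∈ G j, f x ≤ b j)
    (hn : ∀ j ∈ T, ((G j).ncard : ℝ) ≤ n j) : ∑ x ∈ F, f x ≤ ∑ j ∈ T, n j * b j := by
  classical
  calc ∑ x ∈ F, f x ≤ ∑ x ∈ F, ∑ j ∈ T, if x ∈ G j then f x else 0 := by
        refine Finset.sum_le_sum fun x hx ↦ ?_
        obtain ⟨j, hj, hxj⟩ := hG x hx
        calc f x = if x ∈ G j then f x else 0 := (if_pos hxj).symm
          _ ≤ _ := Finset.single_le_sum (f := fun j ↦ if x ∈ G j then f x else 0)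
            (fun i _ ↦ by split_ifs <;> simp [hf x]) hj
    _ = ∑ j ∈ T, ∑ x ∈ F with x ∈ G j, f x := by
        rw [Finset.sum_comm]
        exact Finset.sum_congr rfl fun j _ ↦ (Finset.sum_filter _ _).symm
    _ ≤ ∑ j ∈ T, n j * b j := by
        refine Finset.sum_le_sum fun j hj ↦ ?_
        calc _ ≤ ((F.filter (· ∈ G j)).card : ℝ) * b j := by
              rw [← nsmul_eq_mul]
              exact Finset.sum_le_card_nsmul _ _ _ fun x hx ↦
                hb j hj x (Finset.mem_filter.mp hx).2
          _ ≤ n j * b j := by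
              refine mul_le_mul_of_nonneg_right (le_trans ?_ (hn j hj)) (hb0 j hj)
              rw [Set.ncard_eq_toFinset_card _ (hGfin j)]
              exact_mod_cast Finset.card_le_card fun x hx ↦
                (hGfin j).mem_toFinset.mpr (Finset.mem_filter.mp hx).2

end Averaging

theorem proposition3p2
    (d ℓ : ℕ) (hd : 1 < d) (hℓ : 1 ≤ ℓ)
    (θ ρ c₁ c₃ τ : ℝ) (hθ : 0 < θ) (hρ : 0 < ρ) (hc₁ : 0 < c₁) (hc₃ : 0 < c₃) (hτ : 0 ≤ τ)
    (c₄ c₅ : ℝ → ℝ → ℝ)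
    (hc₄ : ∀ δ : ℝ, 0 < δ → ∀ ε : ℝ, 0 < ε → ε < 1 / (ℓ : ℝ) → 0 < c₄ δ ε)
    (hc₅ : ∀ δ : ℝ, 0 < δ → ∀ ε : ℝ, 0 < ε → ε < 1 / (ℓ : ℝ) → 0 < c₅ δ ε)
    (k : ℝ) (hk : 0 ≤ k) (ε : ℝ) (hε : 0 < ε) (hεℓ : ε < 1 / (ℓ : ℝ)) :
    ∃ C : ℝ, 0 < C ∧ ∀ S : Set NumFieldQbar, S ⊆ fieldsOfDegree d →
      (∀ X : ℝ, 2 ≤ X → ((dyadicPart S X).ncard : ℝ) ≤ c₁ * X ^ ρ) →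
      (∀ X : ℝ, 2 ≤ X → (etaBounded ℓ S X).Finite ∧
        ((etaBounded ℓ S X).ncard : ℝ) ≤ c₃ * X ^ θ) →
      (∀ δ : ℝ, 0 < δ → ∀ ε' : ℝ, 0 < ε' → ε' < 1 / (ℓ : ℝ) → ∀ X : ℝ, 2 ≤ X →
        ((badFields S X (X ^ δ) (c₄ δ ε' * X ^ δ / Real.log X)).ncard : ℝ)
          ≤ c₅ δ ε' * X ^ (τ + ε')) →
      ∀ X : ℝ, 2 ≤ X →
        ∑ K ∈ dyadicFinset S X, (classTorsionCard ℓ K.1 : ℝ) ^ k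
          ≤ C * (X ^ (k / 2 + ρ - ρ * k / (ℓ * θ) + ε) + X ^ (k / 2 + τ + ε)) := by
  classical
  have hℓ0 : (0 : ℝ) < ℓ := by exact_mod_cast hℓ
  have hΘ : 0 < ℓ * θ := by positivity
  -- The class number estimates lose `X ^ ε₁`, the subdivision into levels loses `X ^ (ρ / N)`.
  set ε₁ : ℝ := ε / (8 * (k + 1)) with hε₁def
  have hε₁ : 0 < ε₁ := by positivity
  have hkε₁ : k * (2 * ε₁) ≤ ε / 4 := by
    rw [hε₁def, show k * (2 * (ε / (8 * (k + 1)))) = ε / 4 * (k / (k + 1)) by field_simp; ring]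
    exact mul_le_of_le_one_right (by positivity) (div_le_one_of_le₀ (by linarith) (by linarith))
  obtain ⟨C₀, hC₀, htor⟩ := exists_classTorsionCard_le d ℓ hd.le hℓ ε₁ hε₁
  obtain ⟨N, hN⟩ := exists_nat_gt (4 * ρ / ε)
  have hN0 : (0 : ℝ) < N := lt_trans (by positivity) hN
  have hρN : ρ / N ≤ ε / 4 := by
    rw [div_lt_iff₀ hε] at hN
    rw [div_le_iff₀ hN0]
    linarith
  let δ (j : ℕ) : ℝ := (j / N) * (ρ / (ℓ * θ))
  have hδ (j : ℕ) (hj : 1 ≤ j) : 0 < δ j := by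
    have : (0 : ℝ) < j := by exact_mod_cast hj
    positivity
  have hδ0 (j : ℕ) : 0 ≤ δ j := by positivity
  have hε2 : 0 < ε / 2 := by positivity
  have hε2ℓ : ε / 2 < 1 / (ℓ : ℝ) := by linarith
  set A : ℝ := Real.exp (ℓ * d : ℕ) with hA
  have hA1 : 1 ≤ A := Real.one_le_exp (by positivity)
  let B (j : ℕ) : ℝ := if j = 0 then C₀ else C₀ / (c₄ (δ j) (ε / 2) * ε₁)
  have hB (j : ℕ) : 0 < B j := by
    by_cases hj : j = 0
    · simpa [B, hj] using hC₀
    · have := hc₄ (δ j) (hδ j (by omega)) (ε / 2) hε2 hε2ℓ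
      simp only [B, if_neg hj]
      positivity
  let C₂ : ℝ := c₁ + c₃ * (2 * A) ^ θ
  have hC₂ : 0 < C₂ := by positivity
  refine ⟨∑ j ∈ Finset.Icc 1 N, c₅ (δ j) (ε / 2) * C₀ ^ k +
    ∑ j ∈ Finset.range (N + 1), C₂ * B j ^ k, ?_, ?_⟩
  · refine add_pos_of_nonneg_of_pos (Finset.sum_nonneg fun j hj ↦ ?_)
      (Finset.sum_pos (fun j _ ↦ ?_) ⟨0, by simp⟩)
    · have := hc₅ (δ j) (hδ j (Finset.mem_Icc.mp hj).1) (ε / 2) hε2 hε2ℓ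
      positivity
    · have := hB j
      positivity
  intro S hS hS₁ hS₃ hS₅ X hX
  have hX0 : 0 < X := by linarith
  have hX1 : 1 ≤ X := by linarith
  let bad (j : ℕ) : Set NumFieldQbar :=
    badFields S X (X ^ δ j) (c₄ (δ j) (ε / 2) * X ^ δ j / Real.log X)
  -- `j` is the largest index with `A X ^ (ℓ δ_j) < η_ℓ(K)`, or `0` if there is none; no lower bound
  -- for `η_ℓ(K)` is available on level `0`, no upper bound on level `N`.
  let level (j : ℕ) : Set NumFieldQbar := {K | K ∈ dyadicPart S X ∧
    (j = 0 ∨ (A * X ^ (ℓ * δ j) < etaInvariant ℓ K.1 ∧ K ∉ bad j)) ∧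
    (j < N → etaInvariant ℓ K.1 ≤ A * X ^ (ℓ * δ (j + 1)))}
  have htriv (K : NumFieldQbar) (hK : K ∈ dyadicPart S X) :=
    htor K.1 (hS hK.1) X hK.2.2.le
  have hcover : ∀ K ∈ dyadicFinset S X, ∃ i ∈ (Finset.Icc 1 N).disjSum (Finset.range (N + 1)),
      K ∈ Sum.elim bad level i := by
    intro K hK
    have hK' : K ∈ dyadicPart S X := (dyadicPart_finite S X).mem_toFinset.mp hK
    by_cases hbad : ∃ j ∈ Finset.Icc 1 N, K ∈ bad j
    · obtain ⟨j, hj, hKj⟩ := hbad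
      exact ⟨.inl j, by simpa using hj, hKj⟩
    · push Not at hbad
      let P (j : ℕ) : Prop := j = 0 ∨ A * X ^ (ℓ * δ j) < etaInvariant ℓ K.1
      have hjN : Nat.findGreatest P N ≤ N := Nat.findGreatest_le N
      have hP : P (Nat.findGreatest P N) := Nat.findGreatest_spec (Nat.zero_le N) (Or.inl rfl)
      refine ⟨.inr (Nat.findGreatest P N), by simpa [Nat.lt_succ_iff] using hjN, hK', ?_, ?_⟩
      · by_cases h0 : Nat.findGreatest P N = 0
        · exact Or.inl h0
        · exact Or.inr ⟨hP.resolve_left h0,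
            hbad _ (Finset.mem_Icc.mpr ⟨Nat.one_le_iff_ne_zero.mpr h0, hjN⟩)⟩
      · intro hlt
        have := Nat.findGreatest_is_greatest (Nat.lt_succ_self (Nat.findGreatest P N)) hlt
        simp only [P, Nat.succ_ne_zero, false_or, not_lt] at this
        exact this
  have hsub (i : ℕ ⊕ ℕ) : Sum.elim bad level i ⊆ dyadicPart S X := by
    rcases i with j | j <;> exact fun K hK ↦ hK.1
  have hbadbound (j : ℕ) (K) (hK : K ∈ bad j) :
      (classTorsionCard ℓ K.1 : ℝ) ^ k ≤ C₀ ^ k * X ^ (k * (1 / 2 + ε₁)) := by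
    refine (Real.rpow_le_rpow (Nat.cast_nonneg _) (htriv K hK.1).1 hk).trans_eq ?_
    rw [Real.mul_rpow hC₀.le (by positivity), ← Real.rpow_mul hX0.le, mul_comm k]
  have hlevelbound (j : ℕ) (K) (hK : K ∈ level j) :
      (classTorsionCard ℓ K.1 : ℝ) ^ k ≤ B j ^ k * X ^ (k * (1 / 2 + 2 * ε₁ - δ j)) := by
    have h1 : (classTorsionCard ℓ K.1 : ℝ) ≤ B j * X ^ (1 / 2 + 2 * ε₁ - δ j) := by
      by_cases hj : j = 0
      · refine (htriv K hK.1).1.trans ?_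
        simp only [B, δ, hj, if_true, Nat.cast_zero, zero_div, zero_mul, sub_zero]
        gcongr
        linarith
      · obtain ⟨hη, hnbad⟩ := hK.2.1.resolve_left hj
        have hY : A * (X ^ δ j) ^ ℓ < etaInvariant ℓ K.1 := by
          rwa [← Real.rpow_mul_natCast hX0.le, mul_comm (δ j)]
        have h2 := (htriv K hK.1).2 (X ^ δ j) (by positivity) hY
        have hM : c₄ (δ j) (ε / 2) * X ^ δ j / Real.log X < numSplitPrimes K.1 (X ^ δ j) := by
          by_contra! hle
          exact hnbad ⟨hK.1, hle⟩
        simp only [B, if_neg hj]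
        exact le_of_mul_splitCount_le (Nat.cast_nonneg _) hC₀.le
          (hc₄ _ (hδ j (by omega)) _ hε2 hε2ℓ) hX hε₁ hM h2
    refine (Real.rpow_le_rpow (Nat.cast_nonneg _) h1 hk).trans_eq ?_
    rw [Real.mul_rpow (hB j).le (by positivity), ← Real.rpow_mul hX0.le, mul_comm k]
  have hlevelcard (j : ℕ) (hj : j ∈ Finset.range (N + 1)) :
      ((level j).ncard : ℝ) ≤ C₂ * X ^ (ℓ * θ * δ j + ρ / N) := by
    have hj' : j ≤ N := Nat.lt_succ_iff.mp (Finset.mem_range.mp hj)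
    rcases hj'.lt_or_eq with hlt | heq
    · -- The factor `2` makes the bound on `η_ℓ` strict and the argument at least `2`.
      have h2 : 2 ≤ 2 * A * X ^ (ℓ * δ (j + 1)) := by
        have h3 : 1 ≤ A * X ^ (ℓ * δ (j + 1)) := one_le_mul_of_one_le_of_one_le hA1
          (Real.one_le_rpow hX1 (mul_nonneg hℓ0.le (hδ0 _)))
        linarith
      obtain ⟨hfin, hcard⟩ := hS₃ _ h2
      have hincl : level j ⊆ etaBounded ℓ S (2 * A * X ^ (ℓ * δ (j + 1))) := fun K hK ↦
        ⟨hK.1.1, (hK.2.2 hlt).trans_lt (by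
          have : 0 < A * X ^ (ℓ * δ (j + 1)) := by positivity
          linarith)⟩
      have hexp : ℓ * δ (j + 1) * θ = ℓ * θ * δ j + ρ / N := by
        simp only [δ]
        push_cast
        field_simp
      calc ((level j).ncard : ℝ) ≤ ((etaBounded ℓ S (2 * A * X ^ (ℓ * δ (j + 1)))).ncard : ℝ) :=
            Nat.cast_le.mpr (Set.ncard_le_ncard hincl hfin)
        _ ≤ c₃ * (2 * A) ^ θ * X ^ (ℓ * θ * δ j + ρ / N) := by
            refine hcard.trans_eq ?_
            rw [Real.mul_rpow (by positivity) (by positivity), ← Real.rpow_mul hX0.le, hexp]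
            ring
        _ ≤ _ := by
            gcongr
            exact le_add_of_nonneg_left hc₁.le
    · have hexp : ρ ≤ ℓ * θ * δ j + ρ / N := by
        have h3 : ℓ * θ * δ j = ρ := by
          simp only [δ, heq]
          field_simp
        have : 0 < ρ / N := by positivity
        linarith
      calc ((level j).ncard : ℝ) ≤ ((dyadicPart S X).ncard : ℝ) :=
            Nat.cast_le.mpr (Set.ncard_le_ncard (hsub (.inr j)) (dyadicPart_finite S X))
        _ ≤ c₁ * X ^ ρ := hS₁ X hX
        _ ≤ _ := by
            gcongr
            exact le_add_of_nonneg_right (by positivity)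
  refine (sum_le_of_cover _ _ (fun K ↦ by positivity)
    ((Finset.Icc 1 N).disjSum (Finset.range (N + 1))) (Sum.elim bad level) hcover
    (fun i ↦ (dyadicPart_finite S X).subset (hsub i))
    (Sum.elim (fun _ ↦ C₀ ^ k * X ^ (k * (1 / 2 + ε₁)))
      fun j ↦ B j ^ k * X ^ (k * (1 / 2 + 2 * ε₁ - δ j)))
    (Sum.elim (fun j ↦ c₅ (δ j) (ε / 2) * X ^ (τ + ε / 2))
      fun j ↦ C₂ * X ^ (ℓ * θ * δ j + ρ / N)) ?_ ?_ ?_).trans ?_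
  · rintro (j | j) -
    · simp only [Sum.elim_inl]; positivity
    · have := hB j
      simp only [Sum.elim_inr]; positivity
  · rintro (j | j) - K hK
    · exact hbadbound j K hK
    · exact hlevelbound j K hK
  · rintro (j | j) hj
    · have hj1 : 1 ≤ j ∧ j ≤ N := by simpa using hj
      exact hS₅ (δ j) (hδ j hj1.1) (ε / 2) hε2 hε2ℓ X hX
    · exact hlevelcard j (by simpa using hj)
  · rw [Finset.sum_disjSum, add_mul, Finset.sum_mul, Finset.sum_mul]
    simp only [Sum.elim_inl, Sum.elim_inr]
    refine add_le_add (Finset.sum_le_sum fun j hj ↦ ?_) (Finset.sum_le_sum fun j hj ↦ ?_)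
    · have := hc₅ (δ j) (hδ j (Finset.mem_Icc.mp hj).1) (ε / 2) hε2 hε2ℓ
      rw [mul_mul_mul_comm]
      gcongr
      rw [← Real.rpow_add hX0]
      refine (Real.rpow_le_rpow_of_exponent_le hX1 ?_).trans
        (le_add_of_nonneg_left (by positivity))
      nlinarith [mul_nonneg hk hε₁.le]
    · have hBj := hB j
      rw [mul_mul_mul_comm]
      gcongr
      refine rpow_level_le hΘ hτ hX hε hkε₁ hρN (by positivity) ?_
      rw [div_le_one hN0]
      exact_mod_cast Nat.lt_succ_iff.mp (Finset.mem_range.mp hj)
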